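/- **Theorem.** Let $k$ be an arbitrary field (of any characteristic), let $R=k[X_0,\ldots,X_n]$ with its standard grading, and let $\mathfrak F\colon \mathbb P^n_k\dashrightarrow\mathbb P^m_k$ be a rational map given by $m+1$ forms $\mathbf f=\{f_0,\ldots,f_m\}\subset R$, not all zero, of the same degree $d\ge 1$. The image of $\mathfrak F$ is the closed subset $\operatorname{Proj}(S)\subset\mathbb P^m_k$, where $S=k[Y_0,\ldots,Y_m]/\mathfrak b\simeq k[\mathbf f]$ and $\mathfrak b$ is the ideal of all polynomial relations of $f_0,\ldots,f_m$ over $k$. Let $\phi_1$ be the linear part of the syzygy matrix $\phi$ of $\mathbf f$, i.e. a matrix with $m+1$ rows over $R$ whose columns generate the $k$-vector space of all linear syzygies $(\ell_0,\ldots,\ell_m)$: each $\ell_j\in R$ a form of degree $1$ or zero, and $\sum_j \ell_jf_j=0$. If the image of $\mathfrak F$ has dimension $n$ and $\operatorname{rk}\phi_1=m$ (the maximal possible value, namely $\operatorname{rk}\phi$; when $m=n$ the condition reads $\operatorname{rk}\phi_1=n$), then $\mathfrak F$ is birational onto its image: there are forms $g_0,\ldots,g_n\in S$ of the same degree $\ge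 1$, not all zero, and nonzero homogeneous $F,F'\in R$ such that $F\,X_i=F'\,g_i(\mathbf f)$ for all $i=0,\ldots,n$. -/

import Mathlib

open MvPolynomial

namespace ProjectiveMap

noncomputable section

/-! Rational maps between projective varieties, through homogeneous coordinate rings.

A graded `k`-algebra `A` is given by the family `𝒜 : ℕ → Submodule k A` of its graded pieces. -/

section Data

variable {k A : Type*} [Field k] [CommRing A] [Algebra k A]

/-- A rational datum of degree `d` on `A`: an ordered tuple of forms of `A` of the same degree
`d ≥ 1` such that `A` is torsion-free over `k[f]` and the ideal `(f)` is not contained in any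
minimal prime of `A`. -/
structure IsRationalDatum (𝒜 : ℕ → Submodule k A) {m : ℕ} (d : ℕ) (f : Fin (m + 1) → A) :
    Prop where
  one_le_degree : 1 ≤ d
  mem_degree : ∀ j, f j ∈ 𝒜 d
  torsionFree : Module.IsTorsionFree (Algebra.adjoin k (Set.range f)) A
  not_le_minimalPrime : ∀ P ∈ minimalPrimes A, ¬ Ideal.span (Set.range f) ≤ P

/-- Two ordered tuples of forms are equivalent if they are proportional by means of a fraction of
regular homogeneous elements.  Equivalent rational data represent the same rational map. -/
def AreEquivalent (𝒜 : ℕ → Submodule k A) {m : ℕ} (f f' : Fin (m + 1) → A) : Prop :=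
  ∃ F F' : A, F ∈ nonZeroDivisors A ∧ F' ∈ nonZeroDivisors A ∧
    (∃ i, F ∈ 𝒜 i) ∧ (∃ i, F' ∈ 𝒜 i) ∧ ∀ j, F * f' j = F' * f j

end Data

variable {k : Type*} [Field k] {n m : ℕ}

attribute [local instance] MvPolynomial.gradedAlgebra

/-- The homogeneous ideal `𝔟 ⊆ k[Y₀, …, Yₘ]` of all polynomial relations of `f₀, …, fₘ`. -/
def imageIdeal (f : Fin (m + 1) → MvPolynomial (Fin (n + 1)) k) :
    Ideal (MvPolynomial (Fin (m + 1)) k) :=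
  RingHom.ker (aeval f : MvPolynomial (Fin (m + 1)) k →ₐ[k] MvPolynomial (Fin (n + 1)) k)

/-- The image of the rational map `(f₀ : … : fₘ)`: the closed subset of `ℙᵐ = Proj k[Y₀, …, Yₘ]`
cut out by `imageIdeal f`, with the subspace topology. -/
def image (f : Fin (m + 1) → MvPolynomial (Fin (n + 1)) k) :
    Set (ProjectiveSpectrum (homogeneousSubmodule (Fin (m + 1)) k)) :=
  ProjectiveSpectrum.zeroLocus (homogeneousSubmodule (Fin (m + 1)) k)
    (imageIdeal f : Set (MvPolynomial (Fin (m + 1)) k))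

/-- The homogeneous coordinate ring `S = k[Y₀, …, Yₘ] / 𝔟` of the image. -/
abbrev ImageRing (f : Fin (m + 1) → MvPolynomial (Fin (n + 1)) k) : Type _ :=
  MvPolynomial (Fin (m + 1)) k ⧸ imageIdeal f

/-- The standard grading of `S = k[Y₀, …, Yₘ] / 𝔟`. -/
def imageGrading (f : Fin (m + 1) → MvPolynomial (Fin (n + 1)) k) (e : ℕ) :
    Submodule k (ImageRing f) :=
  (homogeneousSubmodule (Fin (m + 1)) k e).map (Ideal.Quotient.mkₐ k (imageIdeal f)).toLinearMap

/-- The embedding `S ≃ k[f] ⊆ k[X₀, …, Xₙ]`, sending the class of `G(Y)` to `G(f)`. -/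
def evalAt (f : Fin (m + 1) → MvPolynomial (Fin (n + 1)) k) :
    ImageRing f →ₐ[k] MvPolynomial (Fin (n + 1)) k :=
  Ideal.Quotient.liftₐ (imageIdeal f) (aeval f) fun _ h => h

/-- The rational map `ℙⁿ ⇢ ℙᵐ` represented by `f` is birational onto its image: there is a
rational map `g` from the image to `ℙⁿ` such that the composite `g(f)` is equivalent to the
identity `(X₀ : … : Xₙ)` of `ℙⁿ`. -/
def IsBirationalOntoImage (f : Fin (m + 1) → MvPolynomial (Fin (n + 1)) k) : Prop :=
  ∃ (e : ℕ) (g : Fin (n + 1) → ImageRing f),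
    IsRationalDatum (imageGrading f) e g ∧
      AreEquivalent (homogeneousSubmodule (Fin (n + 1)) k) (fun i => evalAt f (g i)) X

/-- The `k`-space of linear syzygies of `f`: the tuples `(ℓ₀, …, ℓₘ)` of linear forms with
`∑ ℓⱼ fⱼ = 0`. -/
def linearSyzygies (f : Fin (m + 1) → MvPolynomial (Fin (n + 1)) k) :
    Submodule k (Fin (m + 1) → MvPolynomial (Fin (n + 1)) k) where
  carrier := {l | (∀ j, (l j).IsHomogeneous 1) ∧ ∑ j, l j * f j = 0}
  zero_mem' := ⟨fun _ => isHomogeneous_zero _ _ _, by simp⟩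
  add_mem' := by
    rintro a b ⟨ha, ha'⟩ ⟨hb, hb'⟩
    exact ⟨fun j => (ha j).add (hb j), by simp [add_mul, Finset.sum_add_distrib, ha', hb']⟩
  smul_mem' := by
    rintro c a ⟨ha, ha'⟩
    refine ⟨fun j => (homogeneousSubmodule (Fin (n + 1)) k 1).smul_mem c (ha j), ?_⟩
    simp [← Finset.smul_sum, ha']

/-- `φ₁` is the linear part of the syzygy matrix of `f`: its columns generate the `k`-space of
linear syzygies of `f`. -/
def IsLinearPart (f : Fin (m + 1) → MvPolynomial (Fin (n + 1)) k) {c : ℕ}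
    (φ₁ : Matrix (Fin (m + 1)) (Fin c) (MvPolynomial (Fin (n + 1)) k)) : Prop :=
  Submodule.span k (Set.range φ₁.col) = linearSyzygies f

section Rank

variable {A : Type*} [CommRing A] {p q : ℕ}

/-- The ideal `I_s(φ)` generated by the `s`-minors of `φ`.  A choice of rows or columns with a
repetition contributes the zero determinant. -/
def minorIdeal (φ : Matrix (Fin p) (Fin q) A) (s : ℕ) : Ideal A :=
  Ideal.span {x | ∃ (a : Fin s → Fin p) (b : Fin s → Fin q), x = (φ.submatrix a b).det}

/-- `φ` has rank `r`: `I_s(φ) = 0` for `s > r`, and `I_r(φ)` contains a regular element. -/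
def HasRank (φ : Matrix (Fin p) (Fin q) A) (r : ℕ) : Prop :=
  (∀ s, r < s → minorIdeal φ s = ⊥) ∧ ∃ x ∈ minorIdeal φ r, x ∈ nonZeroDivisors A

end Rank

end

end ProjectiveMap

/-! Write `x` for the generic point of the source. Substituting unknowns `Z` in the linear syzygies
gives the linear system `∑ j, f j * φ j s (Z) = 0`, with coefficients in `k(f)` and solution `Z =
x`. If every solution is proportional to `x`, then a nonzero solution over `k(f)` expresses the
ratios of the `X i` through `f`, which is the inverse map.

Uniqueness (`mul_X_eq_mul_X_of_transcendental`): for a solution `z` and `t` transcendental over `R`,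
linearity puts `f(x)` in the left kernel of `φ(x + t z)`, which also contains `f(x + t z)`. This
kernel has rank one, so `x` and `x + t z` have the same image. As `R` is algebraic over `k[f]`
(`isAlgebraic_adjoin_of_le_topologicalKrullDim`, from the dimension of the image), fibres are finite
and the coordinate ratios of `x + t z` are algebraic over `R`; this forces `z` to be proportional to
`x`. No derivative or separability enters, so the characteristic is arbitrary.

Existence (`exists_aeval_solution`): a `k(f)`-linear functional applied to the coordinates of `x`
keeps the equations and lands in `k(f)`. -/

/-- The contraction of primes along an injective integral ring map is strictly monotone, so the
dimension does not grow. -/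
theorem ringKrullDim_le_of_isIntegral {A B : Type*} [CommRing A] [CommRing B] [Algebra A B]
    [Algebra.IsIntegral A B] : ringKrullDim B ≤ ringKrullDim A := by
  refine Order.krullDim_le_of_strictMono (PrimeSpectrum.comap (algebraMap A B)) ?_
  intro p q hpq
  exact Ideal.IsIntegral.comap_lt_comap (R := A) (I := p.asIdeal) (J := q.asIdeal) hpq

/-! ### Dimension of the image and generic finiteness. -/

namespace ProjectiveMap

attribute [local instance] MvPolynomial.gradedAlgebra

theorem isPrime_vanishingIdeal {k σ : Type*} [Field k]
    {Z : Set (ProjectiveSpectrum (homogeneousSubmodule σ k))} (hZ : IsIrreducible Z) :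
    (ProjectiveSpectrum.vanishingIdeal Z).toIdeal.IsPrime := by
  constructor
  · intro h
    obtain ⟨x, hx⟩ := hZ.nonempty
    have h1 : (1 : MvPolynomial σ k) ∈ ProjectiveSpectrum.vanishingIdeal Z := by
      rw [← HomogeneousIdeal.mem_iff, h]; trivial
    rw [ProjectiveSpectrum.mem_vanishingIdeal] at h1
    exact x.isPrime.one_notMem (h1 x hx)
  · intro a b hab
    have hab' := (ProjectiveSpectrum.mem_vanishingIdeal _ _).1 hab
    have hsub : Z ⊆ ProjectiveSpectrum.zeroLocus (homogeneousSubmodule σ k) {a} ∪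
        ProjectiveSpectrum.zeroLocus (homogeneousSubmodule σ k) {b} := by
      rw [← ProjectiveSpectrum.zeroLocus_singleton_mul]
      intro x hx
      simpa [ProjectiveSpectrum.mem_zeroLocus] using hab' x hx
    rcases (isPreirreducible_iff_isClosed_union_isClosed.1 hZ.isPreirreducible) _ _
      (ProjectiveSpectrum.isClosed_zeroLocus _ _) (ProjectiveSpectrum.isClosed_zeroLocus _ _)
      hsub with h | h
    · left
      refine (ProjectiveSpectrum.mem_vanishingIdeal _ _).2 fun x hx => ?_
      simpa [ProjectiveSpectrum.mem_zeroLocus] using h hx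
    · right
      refine (ProjectiveSpectrum.mem_vanishingIdeal _ _).2 fun x hx => ?_
      simpa [ProjectiveSpectrum.mem_zeroLocus] using h hx

/-- A proper homogeneous ideal contains no nonzero constant term, and a point of `Proj` does not
contain the irrelevant ideal. This inclusion is the extra step of prime chains in the affine cone.
-/
theorem vanishingIdeal_lt_ker_constantCoeff {k σ : Type*} [Field k]
    {Z : Set (ProjectiveSpectrum (homogeneousSubmodule σ k))} (hZ : Z.Nonempty) :
    (ProjectiveSpectrum.vanishingIdeal Z).toIdeal <
      RingHom.ker (constantCoeff : MvPolynomial σ k →+* k) := by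
  obtain ⟨x, hx⟩ := hZ
  have hle : (ProjectiveSpectrum.vanishingIdeal Z).toIdeal ≤ x.asHomogeneousIdeal.toIdeal :=
    fun p hp => (ProjectiveSpectrum.mem_vanishingIdeal _ _).1 hp x hx
  have hlt : x.asHomogeneousIdeal.toIdeal <
      RingHom.ker (constantCoeff : MvPolynomial σ k →+* k) := by
    refine lt_of_le_not_ge ?_ ?_
    · intro p hp
      have h0 := homogeneousComponent_mem_of_mem x.asHomogeneousIdeal.isHomogeneous hp 0
      rw [homogeneousComponent_zero] at h0
      by_contra hc
      exact x.isPrime.ne_top (Ideal.eq_top_of_isUnit_mem _ h0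
        ((IsUnit.mk0 (coeff 0 p) hc).map C))
    · intro h
      refine x.not_irrelevant_le fun p hp => h ?_
      have h0 : homogeneousComponent 0 p = 0 :=
        (decomposition.decompose'_apply p 0).symm.trans
          ((HomogeneousIdeal.mem_irrelevant_iff _ p).1 hp)
      rw [homogeneousComponent_zero, C_eq_zero] at h0
      exact h0
  exact hle.trans_lt hlt

variable {k : Type*} [Field k] {n m : ℕ}

theorem imageIdeal_le_ker_constantCoeff {d : ℕ} (hd : 1 ≤ d)
    {f : Fin (m + 1) → MvPolynomial (Fin (n + 1)) k} (hf : ∀ j, (f j).IsHomogeneous d) :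
    imageIdeal f ≤ RingHom.ker (constantCoeff : MvPolynomial (Fin (m + 1)) k →+* k) := by
  intro p hp
  have h1 : aeval f p = 0 := hp
  have h2 : (constantCoeff.comp (aeval f : MvPolynomial (Fin (m + 1)) k →ₐ[k] _).toRingHom) =
      (constantCoeff : MvPolynomial (Fin (m + 1)) k →+* k) := by
    refine MvPolynomial.ringHom_ext (by simp) fun j => ?_
    have : coeff 0 (f j) = 0 := (hf j).coeff_eq_zero (by simpa using by omega)
    simpa [constantCoeff_eq] using this
  have h3 : constantCoeff (aeval f p) = constantCoeff p := RingHom.congr_fun h2 p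
  rw [RingHom.mem_ker, ← h3, h1, map_zero]

open TopologicalSpace in
/-- The affine cone over the image has dimension one more than the image. -/
theorem topologicalKrullDim_image_add_one_le {d : ℕ} (hd : 1 ≤ d)
    {f : Fin (m + 1) → MvPolynomial (Fin (n + 1)) k} (hf : ∀ j, (f j).IsHomogeneous d) :
    topologicalKrullDim (image f) + 1 ≤ ringKrullDim (ImageRing f) := by
  rcases isEmpty_or_nonempty (IrreducibleCloseds (image f)) with he | hne
  · rw [topologicalKrullDim, Order.krullDim_eq_bot]
    simp
  have hcl : ∀ Z : IrreducibleCloseds (image f),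
      IsClosed (Subtype.val '' (Z : Set (image f)) :
        Set (ProjectiveSpectrum (homogeneousSubmodule (Fin (m + 1)) k))) := fun Z =>
    (ProjectiveSpectrum.isClosed_zeroLocus _ _).isClosedEmbedding_subtypeVal.isClosedMap _
      Z.isClosed
  have hir : ∀ Z : IrreducibleCloseds (image f),
      IsIrreducible (Subtype.val '' (Z : Set (image f)) :
        Set (ProjectiveSpectrum (homogeneousSubmodule (Fin (m + 1)) k))) := fun Z =>
    Z.isIrreducible.image _ continuous_subtype_val.continuousOn
  -- The added bottom element plays the empty set and goes to the irrelevant ideal, the vertex of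
  -- the cone; it accounts for the `+ 1`.
  let I : WithBot (IrreducibleCloseds (image f)) → Ideal (MvPolynomial (Fin (m + 1)) k) :=
    fun Z => Z.recBotCoe (RingHom.ker constantCoeff)
      fun Z => (ProjectiveSpectrum.vanishingIdeal
        (Subtype.val '' (Z : Set (image f)))).toIdeal
  have hprime : ∀ Z, (I Z).IsPrime := fun Z => by
    cases Z with
    | bot => exact RingHom.ker_isPrime _
    | coe Z => exact isPrime_vanishingIdeal (hir Z)
  have hle : ∀ Z, imageIdeal f ≤ I Z := fun Z => by
    cases Z with
    | bot => exact imageIdeal_le_ker_constantCoeff hd hf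
    | coe Z =>
      intro p hp
      refine (ProjectiveSpectrum.mem_vanishingIdeal _ _).2 ?_
      rintro _ ⟨x, -, rfl⟩
      exact x.2 hp
  have hanti : ∀ Z W, Z < W → I W < I Z := fun Z W h => by
    cases W with
    | bot => exact absurd h not_lt_bot
    | coe W =>
      cases Z with
      | bot => exact vanishingIdeal_lt_ker_constantCoeff (hir W).nonempty
      | coe Z =>
        have hZW : Z < W := WithBot.coe_lt_coe.1 h
        have hVI : I W ≤ I Z := by
          have := ProjectiveSpectrum.vanishingIdeal_anti_mono
            (homogeneousSubmodule (Fin (m + 1)) k) (Set.image_mono (f := Subtype.val) hZW.le)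
          exact this
        refine lt_of_le_not_ge hVI fun hge => ?_
        have h1 := ProjectiveSpectrum.zeroLocus_anti_mono_ideal
          (homogeneousSubmodule (Fin (m + 1)) k) hge
        have h2 := ProjectiveSpectrum.zeroLocus_vanishingIdeal_eq_closure
          (homogeneousSubmodule (Fin (m + 1)) k) (Subtype.val '' (W : Set (image f)))
        have h3 := ProjectiveSpectrum.zeroLocus_vanishingIdeal_eq_closure
          (homogeneousSubmodule (Fin (m + 1)) k) (Subtype.val '' (Z : Set (image f)))
        rw [(hcl W).closure_eq] at h2
        rw [(hcl Z).closure_eq] at h3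
        exact hZW.not_ge ((Set.image_subset_image_iff Subtype.val_injective).1
          (h2.symm.subset.trans (h1.trans h3.subset)))
  rw [topologicalKrullDim, ← Order.krullDim_withBot, ← Order.krullDim_orderDual,
    ringKrullDim_quotient]
  exact Order.krullDim_le_of_strictMono
    (fun Z => ⟨⟨I (OrderDual.ofDual Z), hprime _⟩, hle _⟩) fun Z W h => hanti _ _ h

theorem evalAt_injective (f : Fin (m + 1) → MvPolynomial (Fin (n + 1)) k) :
    Function.Injective (evalAt f) := by
  refine (injective_iff_map_eq_zero _).2 fun a => ?_
  obtain ⟨p, rfl⟩ := Ideal.Quotient.mk_surjective a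
  exact fun h => Ideal.Quotient.eq_zero_iff_mem.2 h

/-- If the image of `(f₀ : … : fₘ)` has dimension at least `n`, then the map is generically
finite. -/
theorem isAlgebraic_adjoin_of_le_topologicalKrullDim {d : ℕ} (hd : 1 ≤ d)
    {f : Fin (m + 1) → MvPolynomial (Fin (n + 1)) k} (hf : ∀ j, (f j).IsHomogeneous d)
    (hdim : (n : WithBot ℕ∞) ≤ topologicalKrullDim (image f)) :
    Algebra.IsAlgebraic (Algebra.adjoin k (Set.range f)) (MvPolynomial (Fin (n + 1)) k) := by
  have h1 : ((n + 1 : ℕ) : WithBot ℕ∞) ≤ ringKrullDim (ImageRing f) := by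
    refine le_trans ?_ (topologicalKrullDim_image_add_one_le hd hf)
    push_cast
    gcongr
  have hne : imageIdeal f ≠ ⊤ := RingHom.ker_ne_top _
  have : Nontrivial (ImageRing f) := Ideal.Quotient.nontrivial_iff.2 hne
  -- Noether normalization: integrality bounds the dimension by `s`, so `s ≥ n + 1`.
  obtain ⟨s, g, hg, hgi⟩ := exists_integral_inj_algHom_of_fg k (ImageRing f)
  have hs : n + 1 ≤ s := by
    have h2 : ringKrullDim (ImageRing f) ≤ ringKrullDim (MvPolynomial (Fin s) k) := by
      algebraize [g.toRingHom]
      exact ringKrullDim_le_of_isIntegral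
    rw [MvPolynomial.ringKrullDim_of_isNoetherianRing, ringKrullDim_eq_zero_of_field] at h2
    have := h1.trans h2
    simp only [Nat.card_eq_fintype_card, Fintype.card_fin, zero_add] at this
    exact_mod_cast this
  let y : Fin s → MvPolynomial (Fin (n + 1)) k := fun i => evalAt f (g (X i))
  have hy : AlgebraicIndependent k y := by
    have : (aeval y : MvPolynomial (Fin s) k →ₐ[k] _) = (evalAt f).comp g := by
      ext i; simp [y]
    rw [AlgebraicIndependent, this]
    exact (evalAt_injective f).comp hg
  -- At least `n + 1` independent elements exhaust the transcendence degree `n + 1` of `R`.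
  have hb : IsTranscendenceBasis k y := by
    refine hy.isTranscendenceBasis_of_lift_trdeg_le_of_finite ?_
    rw [MvPolynomial.trdeg_of_isDomain]
    simpa using hs
  have halg := hb.isAlgebraic
  have hsub : Algebra.adjoin k (Set.range y) ≤ Algebra.adjoin k (Set.range f) := by
    refine Algebra.adjoin_le ?_
    rintro _ ⟨i, rfl⟩
    obtain ⟨p, hp⟩ := Ideal.Quotient.mk_surjective (g (X i))
    have : y i = aeval f p := by simp only [y]; rw [← hp]; rfl
    rw [this, Algebra.adjoin_range_eq_range_aeval]
    exact ⟨p, rfl⟩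
  exact ⟨fun a => (halg.isAlgebraic a).tower_top_of_subalgebra_le hsub⟩

end ProjectiveMap

/-! ### Rank-one kernels, homogeneous substitution and transcendental elements. -/

/-- The left kernel of a matrix with `m + 1` rows and a nonzero `m`-minor has rank one. -/
theorem Matrix.exists_mul_eq_mul_of_vecMul_eq_zero {A : Type*} [CommRing A] [IsDomain A]
    {m c : ℕ} {φ : Matrix (Fin (m + 1)) (Fin c) A} {a : Fin m → Fin (m + 1)} {b : Fin m → Fin c}
    (hdet : (φ.submatrix a b).det ≠ 0) {u w : Fin (m + 1) → A} (hu : u ≠ 0)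
    (huφ : Matrix.vecMul u φ = 0) (hwφ : Matrix.vecMul w φ = 0) :
    ∃ j, u j ≠ 0 ∧ ∀ i, u i * w j = w i * u j := by
  have ha : Function.Injective a := by
    intro s t hst
    by_contra hne
    exact hdet (Matrix.det_zero_of_row_eq hne (by ext; simp [hst]))
  have hcard : (Finset.univ.image a)ᶜ.card = 1 := by
    rw [Finset.card_compl, Finset.card_image_of_injective _ ha]
    simp
  obtain ⟨j, hj⟩ := Finset.card_eq_one.1 hcard
  have hmem : ∀ i, i ∉ Set.range a → i = j := by
    intro i hi
    have : i ∈ (Finset.univ.image a)ᶜ := by simpa using hi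
    simpa [hj] using this
  -- The nonzero minor uses every row except `j`, so a kernel vector is determined by its entry at
  -- `j`.
  have key : ∀ v : Fin (m + 1) → A, Matrix.vecMul v φ = 0 → v j = 0 → v = 0 := by
    intro v hv hvj
    have h1 : Matrix.vecMul (v ∘ a) (φ.submatrix a b) = 0 := by
      ext t
      have h2 := congrFun hv (b t)
      simp only [Matrix.vecMul, dotProduct, Pi.zero_apply] at h2 ⊢
      rw [← h2]
      refine Fintype.sum_of_injective a ha _ _ (fun i hi => ?_) fun i => rfl
      rw [hmem i hi, hvj, zero_mul]
    have h2 := Matrix.eq_zero_of_vecMul_eq_zero hdet h1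
    ext i
    by_cases hi : i ∈ Set.range a
    · obtain ⟨s, rfl⟩ := hi
      exact congrFun h2 s
    · rw [hmem i hi, hvj]; rfl
  refine ⟨j, fun h => hu (key u huφ h), fun i => ?_⟩
  have h1 := key (w j • u - u j • w)
    (by rw [Matrix.sub_vecMul, Matrix.smul_vecMul, Matrix.smul_vecMul, huφ, hwφ]; simp)
    (by simp [mul_comm])
  have h2 := congrFun h1 i
  simp only [Pi.sub_apply, Pi.smul_apply, smul_eq_mul, Pi.zero_apply] at h2
  linear_combination h2

namespace MvPolynomial

theorem aeval_eq_sum_of_isHomogeneous_one {k σ B : Type*} [Fintype σ] [CommSemiring k]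
    [CommSemiring B] [Algebra k B] {l : MvPolynomial σ k} (hl : l.IsHomogeneous 1) (x : σ → B) :
    aeval x l = ∑ i, coeff (Finsupp.single i 1) l • x i := by
  classical
  have hl' : l ∈ Submodule.span k (Set.range (X : σ → MvPolynomial σ k)) := by
    rw [← homogeneousSubmodule_one_eq_span_X]; exact hl
  clear hl
  induction hl' using Submodule.span_induction with
  | mem p hp =>
    obtain ⟨i, rfl⟩ := hp
    simp [coeff_X, Finsupp.single_left_inj, ite_smul]
  | zero => simp
  | add p q _ _ hp hq => simp [hp, hq, add_smul, Finset.sum_add_distrib]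
  | smul c p _ hp => simp [hp, mul_smul, Finset.smul_sum]

theorem aeval_mul_of_isHomogeneous {k σ B : Type*} [CommSemiring k] [CommSemiring B]
    [Algebra k B] {p : MvPolynomial σ k} {d : ℕ} (hp : p.IsHomogeneous d) (r : B) (x : σ → B) :
    aeval (fun i => r * x i) p = r ^ d * aeval x p := by
  rw [aeval_def, eval₂_eq, aeval_def, eval₂_eq, Finset.mul_sum]
  refine Finset.sum_congr rfl fun e he => ?_
  have hd : ∑ i ∈ e.support, e i = d := by
    have := hp (mem_support_iff.1 he)
    simpa [Finsupp.weight_apply, Finsupp.sum] using this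
  simp only [mul_pow, Finset.prod_mul_distrib, Finset.prod_pow_eq_pow_sum, hd]
  ring

end MvPolynomial

/-- A domain has an algebraically closed extension field that is not algebraic over it. -/
theorem exists_isAlgClosed_transcendental.{u} (R : Type u) [CommRing R] [IsDomain R] :
    ∃ (Ω : Type u) (_ : Field Ω) (_ : IsAlgClosed Ω) (_ : Algebra R Ω) (_ : FaithfulSMul R Ω)
      (t : Ω), Transcendental R t := by
  let φ : Polynomial R →+* AlgebraicClosure (FractionRing (Polynomial R)) :=
    (algebraMap (FractionRing (Polynomial R))
      (AlgebraicClosure (FractionRing (Polynomial R)))).comp (algebraMap _ _)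
  have hφ : Function.Injective φ :=
    (algebraMap (FractionRing (Polynomial R))
      (AlgebraicClosure (FractionRing (Polynomial R)))).injective.comp
      (FaithfulSMul.algebraMap_injective (Polynomial R) (FractionRing (Polynomial R)))
  let alg : Algebra R (AlgebraicClosure (FractionRing (Polynomial R))) :=
    (φ.comp Polynomial.C).toAlgebra
  refine ⟨AlgebraicClosure (FractionRing (Polynomial R)), inferInstance, inferInstance, alg,
    (faithfulSMul_iff_algebraMap_injective _ _).2 (hφ.comp Polynomial.C_injective),
    φ Polynomial.X, ?_⟩
  rw [transcendental_iff]
  intro p hp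
  have : Polynomial.aeval (φ Polynomial.X) p = φ p := by
    rw [Polynomial.aeval_def]
    change Polynomial.eval₂ (φ.comp Polynomial.C) (φ Polynomial.X) p = φ p
    rw [← Polynomial.hom_eval₂, Polynomial.eval₂_C_X]
  exact (map_eq_zero_iff φ hφ).1 (this.symm.trans hp)

/-! ### Uniqueness of the solution of the linear fibre equations. -/

namespace ProjectiveMap

variable {k : Type*} [Field k] {n m : ℕ}

/-- Translating the generic point along a direction `Z` is injective. -/
theorem aeval_add_mul_injective {Ω : Type*} [Field Ω] [Algebra k Ω]
    [Algebra (MvPolynomial (Fin (n + 1)) k) Ω] [IsScalarTower k (MvPolynomial (Fin (n + 1)) k) Ω]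
    {t : Ω} (ht : Transcendental (MvPolynomial (Fin (n + 1)) k) t)
    (Z : Fin (n + 1) → MvPolynomial (Fin (n + 1)) k) :
    Function.Injective (aeval (fun i => algebraMap (MvPolynomial (Fin (n + 1)) k) Ω (X i) +
      t * algebraMap (MvPolynomial (Fin (n + 1)) k) Ω (Z i)) :
        MvPolynomial (Fin (n + 1)) k →ₐ[k] Ω) := by
  let ρ : MvPolynomial (Fin (n + 1)) k →ₐ[k] Polynomial (MvPolynomial (Fin (n + 1)) k) :=
    aeval fun i => Polynomial.C (X i) + Polynomial.X * Polynomial.C (Z i)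
  -- Setting the polynomial variable to `0` undoes the translation.
  have hρ : Function.LeftInverse (Polynomial.evalRingHom (0 : MvPolynomial (Fin (n + 1)) k)) ρ := by
    intro p
    have : (Polynomial.evalRingHom (0 : MvPolynomial (Fin (n + 1)) k)).comp ρ.toRingHom =
        RingHom.id (MvPolynomial (Fin (n + 1)) k) := by
      refine MvPolynomial.ringHom_ext (fun r => ?_) fun i => ?_
      · have : ρ (C r) = Polynomial.C (C r) := by
          simp only [ρ]; rw [aeval_C]; rfl
        simp [this]
      · simp only [ρ]; simp
    exact RingHom.congr_fun this p
  have hcomp : (aeval (fun i => algebraMap (MvPolynomial (Fin (n + 1)) k) Ω (X i) +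
      t * algebraMap (MvPolynomial (Fin (n + 1)) k) Ω (Z i)) :
        MvPolynomial (Fin (n + 1)) k →ₐ[k] Ω) =
      ((Polynomial.aeval t : Polynomial (MvPolynomial (Fin (n + 1)) k) →ₐ[MvPolynomial (Fin (n + 1)) k]
        Ω).restrictScalars k).comp ρ := by
    ext i
    simp only [ρ]
    simp [mul_comm t]
  rw [hcomp]
  exact (transcendental_iff_injective.1 ht).comp hρ.injective

/-- A solution not proportional to `x` would span with it a line in the fibre of `x`; a point of
that line with transcendental parameter `t` contradicts generic finiteness. -/
theorem mul_X_eq_mul_X_of_transcendental {Ω : Type*} [Field Ω]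
    [IsAlgClosed Ω] [Algebra k Ω] [Algebra (MvPolynomial (Fin (n + 1)) k) Ω]
    [IsScalarTower k (MvPolynomial (Fin (n + 1)) k) Ω]
    [FaithfulSMul (MvPolynomial (Fin (n + 1)) k) Ω]
    {t : Ω} (ht : Transcendental (MvPolynomial (Fin (n + 1)) k) t) {d c : ℕ} (hd : 1 ≤ d)
    {f : Fin (m + 1) → MvPolynomial (Fin (n + 1)) k} (hf : ∀ j, (f j).IsHomogeneous d)
    (hf0 : f ≠ 0)
    (halg : Algebra.IsAlgebraic (Algebra.adjoin k (Set.range f)) (MvPolynomial (Fin (n + 1)) k))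
    {φ : Matrix (Fin (m + 1)) (Fin c) (MvPolynomial (Fin (n + 1)) k)}
    (hφ : ∀ i j, (φ i j).IsHomogeneous 1) (hfφ : Matrix.vecMul f φ = 0)
    {a : Fin m → Fin (m + 1)} {b : Fin m → Fin c} (hdet : (φ.submatrix a b).det ≠ 0)
    {Z : Fin (n + 1) → MvPolynomial (Fin (n + 1)) k}
    (hZ : ∀ s, ∑ j, f j * aeval Z (φ j s) = 0) (i j : Fin (n + 1)) :
    Z i * X j = Z j * X i := by
  let ι := algebraMap (MvPolynomial (Fin (n + 1)) k) Ω
  have hι : Function.Injective ι := FaithfulSMul.algebraMap_injective _ _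
  let x : Fin (n + 1) → Ω := fun i => ι (X i)
  let z : Fin (n + 1) → Ω := fun i => ι (Z i)
  let σ : MvPolynomial (Fin (n + 1)) k →ₐ[k] Ω := aeval fun i => x i + t * z i
  have hσ : Function.Injective σ := aeval_add_mul_injective ht Z
  have hx : ∀ p : MvPolynomial (Fin (n + 1)) k, aeval x p = ι p := fun p => by
    have : (aeval x : MvPolynomial (Fin (n + 1)) k →ₐ[k] Ω) =
        IsScalarTower.toAlgHom k (MvPolynomial (Fin (n + 1)) k) Ω := by ext; simp [x, ι]
    rw [this]; rfl
  have hz : ∀ p : MvPolynomial (Fin (n + 1)) k, aeval z p = ι (aeval Z p) := fun p => by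
    have : (aeval z : MvPolynomial (Fin (n + 1)) k →ₐ[k] Ω) =
        (IsScalarTower.toAlgHom k (MvPolynomial (Fin (n + 1)) k) Ω).comp (aeval Z) := by
      ext; simp [z, ι]
    rw [this]; rfl
  have hσ1 : ∀ l : MvPolynomial (Fin (n + 1)) k, l.IsHomogeneous 1 →
      σ l = ι l + t * ι (aeval Z l) := fun l hl => by
    rw [← hx, ← hz]
    simp only [σ]
    simp only [aeval_eq_sum_of_isHomogeneous_one hl]
    rw [Finset.mul_sum,
      ← Finset.sum_add_distrib]
    simp only [smul_add, mul_smul_comm]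
  -- The matrix is `φ(x + t z)`; its `m`-minor survives because `σ` is injective. It kills `f(x)` by
  -- linearity of the entries and `f(x + t z)` by the syzygies themselves.
  obtain ⟨j0, hj0, hprop⟩ := Matrix.exists_mul_eq_mul_of_vecMul_eq_zero
    (φ := φ.map σ) (a := a) (b := b) (u := fun i => ι (f i)) (w := fun i => σ (f i))
    (by
      have : (φ.map σ).submatrix a b = σ.toRingHom.mapMatrix (φ.submatrix a b) := rfl
      rw [this, ← RingHom.map_det]
      exact (map_ne_zero_iff _ hσ).2 hdet)
    (fun h => hf0 (funext fun i => (map_eq_zero_iff _ hι).1 (congrFun h i)))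
    (by
      ext s
      have h1 := congrArg ι (congrFun hfφ s)
      have h2 := congrArg ι (hZ s)
      simp only [Matrix.vecMul, dotProduct, Matrix.map_apply, Pi.zero_apply, map_sum, map_mul,
        map_zero] at h1 h2 ⊢
      simp only [hσ1 _ (hφ _ _), mul_add, Finset.sum_add_distrib, h1, zero_add,
        mul_left_comm _ t, ← Finset.mul_sum, h2, mul_zero])
    (by
      ext s
      have h1 := congrArg σ (congrFun hfφ s)
      simpa only [Matrix.vecMul, dotProduct, Matrix.map_apply, Pi.zero_apply, map_sum, map_mul,
        map_zero] using h1)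
  have hfj0 : f j0 ≠ 0 := fun h => hj0 (by simp [h])
  have hσj0 : σ (f j0) ≠ 0 := (map_ne_zero_iff _ hσ).2 hfj0
  -- Rescaling by a `d`-th root turns proportionality into equality: `f(μ (x + t z)) = f(x)`.
  obtain ⟨μ, hμ⟩ := IsAlgClosed.exists_pow_nat_eq (ι (f j0) / σ (f j0)) (n := d) (by omega)
  have hμ0 : μ ≠ 0 := by
    rintro rfl
    rw [zero_pow (by omega)] at hμ
    exact div_ne_zero hj0 hσj0 hμ.symm
  let θ : MvPolynomial (Fin (n + 1)) k →ₐ[k] Ω := aeval fun i => μ * (x i + t * z i)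
  have hθ : ∀ i, θ (f i) = ι (f i) := fun i => by
    simp only [θ]
    rw [aeval_mul_of_isHomogeneous (hf i), hμ, div_mul_eq_mul_div, div_eq_iff hσj0]
    linear_combination -hprop i
  -- `θ` agrees with `ι` on `k[f]`, so it carries algebraic equations over `k[f]` to equations over
  -- `R`.
  have hθalg : ∀ p, IsAlgebraic (MvPolynomial (Fin (n + 1)) k) (θ p) := fun p => by
    refine (halg.isAlgebraic p).ringHom_of_comp_eq
      (algebraMap (Algebra.adjoin k (Set.range f)) (MvPolynomial (Fin (n + 1)) k)) θ Subtype.val_injective ?_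
    have : Set.EqOn (IsScalarTower.toAlgHom k (MvPolynomial (Fin (n + 1)) k) Ω) θ
        (Algebra.adjoin k (Set.range f)) := by
      refine (AlgHom.adjoin_le_equalizer _ _ ?_)
      rintro _ ⟨i, rfl⟩
      exact (hθ i).symm
    ext r
    exact this r.2
  let q := θ (X i) / θ (X j)
  have hq : IsAlgebraic (MvPolynomial (Fin (n + 1)) k) q := by
    simp only [q, div_eq_mul_inv]
    exact (hθalg _).mul (hθalg _).inv
  have hj : x j + t * z j ≠ 0 := by
    have : σ (X j) ≠ 0 := (map_ne_zero_iff _ hσ).2 (X_ne_zero j)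
    simpa only [σ, aeval_X] using this
  have hqeq : x i + t * z i = q * (x j + t * z j) := by
    simp only [q, θ, aeval_X]
    rw [mul_div_mul_left _ _ hμ0, div_mul_cancel₀ _ hj]
  have hιalg : ∀ r, IsAlgebraic (MvPolynomial (Fin (n + 1)) k) (ι r) := fun r => isAlgebraic_algebraMap r
  -- Otherwise `hqeq` could be solved for `t`, making `t` algebraic over `R`.
  have hzq : z i = q * z j := by
    by_contra hne
    have hne' : z i - q * z j ≠ 0 := sub_ne_zero.2 hne
    have hteq : t = (q * x j - x i) * (z i - q * z j)⁻¹ := by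
      rw [eq_mul_inv_iff_mul_eq₀ hne']
      linear_combination hqeq
    refine ht ?_
    rw [hteq]
    exact ((hq.mul (hιalg _)).sub (hιalg _)).mul ((hιalg _).sub (hq.mul (hιalg _))).inv
  have hxq : x i = q * x j := by linear_combination hqeq - t * hzq
  apply hι
  rw [map_mul, map_mul]
  change z i * x j = z j * x i
  rw [hzq, hxq]
  ring

/-- If `f` is generically finite and its linear syzygies have rank `m`, then the linear space of
points satisfying the linear equations of the fibre through the generic point is that point. -/
theorem mul_X_eq_mul_X_of_linear_syzygies {d c : ℕ} (hd : 1 ≤ d)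
    {f : Fin (m + 1) → MvPolynomial (Fin (n + 1)) k} (hf : ∀ j, (f j).IsHomogeneous d)
    (hf0 : f ≠ 0)
    (halg : Algebra.IsAlgebraic (Algebra.adjoin k (Set.range f)) (MvPolynomial (Fin (n + 1)) k))
    {φ : Matrix (Fin (m + 1)) (Fin c) (MvPolynomial (Fin (n + 1)) k)}
    (hφ : ∀ i j, (φ i j).IsHomogeneous 1) (hfφ : Matrix.vecMul f φ = 0)
    {a : Fin m → Fin (m + 1)} {b : Fin m → Fin c} (hdet : (φ.submatrix a b).det ≠ 0)
    {Z : Fin (n + 1) → MvPolynomial (Fin (n + 1)) k}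
    (hZ : ∀ s, ∑ j, f j * aeval Z (φ j s) = 0) (i j : Fin (n + 1)) :
    Z i * X j = Z j * X i := by
  obtain ⟨Ω, _, _, _, _, t, ht⟩ :=
    exists_isAlgClosed_transcendental (MvPolynomial (Fin (n + 1)) k)
  algebraize [(algebraMap (MvPolynomial (Fin (n + 1)) k) Ω).comp
    (algebraMap k (MvPolynomial (Fin (n + 1)) k))]
  exact mul_X_eq_mul_X_of_transcendental ht hd hf hf0 halg hφ hfφ hdet hZ i j

end ProjectiveMap

/-! ### A solution in `k[f]` and its homogeneous components. -/

theorem MvPolynomial.homogeneousComponent_aeval {k σ τ : Type*} [CommSemiring k] {d : ℕ}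
    (hd : 1 ≤ d) {f : σ → MvPolynomial τ k} (hf : ∀ j, (f j).IsHomogeneous d)
    (p : MvPolynomial σ k) (e : ℕ) :
    homogeneousComponent (d * e) (aeval f p) = aeval f (homogeneousComponent e p) := by
  have hmul : ∀ i, (aeval f (homogeneousComponent i p)) ∈ homogeneousSubmodule τ k (d * i) :=
    fun i => (homogeneousComponent_isHomogeneous i p).aeval f hf
  conv_lhs => rw [← sum_homogeneousComponent p]
  simp only [map_sum, homogeneousComponent_of_mem (hmul _)]
  simp only [Nat.mul_right_inj (show d ≠ 0 by omega)]
  rw [Finset.sum_ite_eq]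
  split_ifs with h
  · rfl
  · rw [homogeneousComponent_eq_zero _ _ (by simpa using h), map_zero]

namespace ProjectiveMap

attribute [local instance] MvPolynomial.gradedAlgebra

variable {k : Type*} [Field k] {n m : ℕ}

theorem homogeneousComponent_mul_X {σ : Type*} (p : MvPolynomial σ k) (e : ℕ) (j : σ) :
    homogeneousComponent (e + 1) (p * X j) = homogeneousComponent e p * X j := by
  have h := DirectSum.coe_decompose_mul_add_of_right_mem (homogeneousSubmodule σ k) (i := e)
    (a := p) (isHomogeneous_X k j : X j ∈ homogeneousSubmodule σ k 1)
  have h1 := decomposition.decompose'_apply (p * X j) (e + 1)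
  have h2 := decomposition.decompose'_apply p e
  exact h1.symm.trans (h.trans (congrArg (· * X j) h2))

/-- The linear equations of the fibre through the generic point have a nonzero solution with
coordinates in `k[f]`. -/
theorem exists_aeval_solution (K : Type*) [Field K] [Algebra k K] [Algebra (MvPolynomial (Fin (n + 1)) k) K]
    [IsScalarTower k (MvPolynomial (Fin (n + 1)) k) K] [FaithfulSMul (MvPolynomial (Fin (n + 1)) k) K] {c : ℕ}
    (f : Fin (m + 1) → MvPolynomial (Fin (n + 1)) k)
    {φ : Matrix (Fin (m + 1)) (Fin c) (MvPolynomial (Fin (n + 1)) k)}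
    (hφ : ∀ i j, (φ i j).IsHomogeneous 1) (hfφ : Matrix.vecMul f φ = 0) :
    ∃ G : Fin (n + 1) → MvPolynomial (Fin (m + 1)) k, aeval f (G 0) ≠ 0 ∧
      ∀ s, ∑ j, f j * aeval (fun i => aeval f (G i)) (φ j s) = 0 := by
  let ι := algebraMap (MvPolynomial (Fin (n + 1)) k) K
  have hι : Function.Injective ι := FaithfulSMul.algebraMap_injective _ _
  let fK : Fin (m + 1) → K := fun j => ι (f j)
  have hfK : ∀ p, aeval fK p = ι (aeval f p) := fun p => by
    have : (aeval fK : MvPolynomial (Fin (m + 1)) k →ₐ[k] K) =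
        (IsScalarTower.toAlgHom k (MvPolynomial (Fin (n + 1)) k) K).comp (aeval f) := by
      ext; simp [fK, ι]
    rw [this]; rfl
  let L := IntermediateField.adjoin k (Set.range fK)
  let fL : Fin (m + 1) → L := fun j => ⟨fK j, IntermediateField.subset_adjoin k _ ⟨j, rfl⟩⟩
  let x : Fin (n + 1) → K := fun i => ι (X i)
  have hx0 : x 0 ≠ 0 := (map_ne_zero_iff _ hι).2 (X_ne_zero 0)
  -- The functional need not be multiplicative: the equations are linear over `L = k(f)`.
  obtain ⟨τ, hτ⟩ : ∃ τ : Module.Dual L K, τ (x 0) ≠ 0 := by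
    by_contra! h
    exact hx0 ((Module.forall_dual_apply_eq_zero_iff L (x 0)).1 h)
  have hfrac : ∀ i, ∃ r s : MvPolynomial (Fin (m + 1)) k, aeval f s ≠ 0 ∧
      (τ (x i) : K) * ι (aeval f s) = ι (aeval f r) := fun i => by
    obtain ⟨r, s, hrs⟩ := (IntermediateField.mem_adjoin_range_iff k fK _).1 (τ (x i)).2
    rw [hfK, hfK] at hrs
    -- The quotient describing `τ (x i)` may have denominator zero, in which case its value is `0`
    -- and `0 / 1` replaces it.
    by_cases hs : aeval f s = 0
    · refine ⟨0, 1, by simp, ?_⟩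
      rw [hrs, hs]; simp
    · refine ⟨r, s, hs, ?_⟩
      rw [hrs, div_mul_cancel₀ _ ((map_ne_zero_iff _ hι).2 hs)]
  choose r s hs hrs using hfrac
  let D := ∏ i, s i
  have hD : aeval f D ≠ 0 := by
    rw [map_prod]; exact Finset.prod_ne_zero_iff.2 fun i _ => hs i
  let G : Fin (n + 1) → MvPolynomial (Fin (m + 1)) k := fun i =>
    r i * ∏ j ∈ Finset.univ.erase i, s j
  have hG : ∀ i, ι (aeval f (G i)) = ι (aeval f D) * (τ (x i) : K) := fun i => by
    have : D = s i * ∏ j ∈ Finset.univ.erase i, s j :=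
      (Finset.mul_prod_erase _ _ (Finset.mem_univ i)).symm
    rw [this]
    simp only [G, map_mul]
    rw [← hrs i]
    ring
  refine ⟨G, fun h => ?_, fun q => ?_⟩
  · have := hG 0
    rw [h, map_zero] at this
    rcases mul_eq_zero.1 this.symm with h1 | h1
    · exact hD ((map_eq_zero_iff _ hι).1 h1)
    · exact hτ (by exact_mod_cast h1)
  -- Regrouping a syzygy by the variables `x i` rather than by the `f j` exhibits its coefficients
  -- in `L`.
  let β : Fin (n + 1) → L := fun i => ∑ j, coeff (Finsupp.single i 1) (φ j q) • fL j
  have hβ : ∑ i, β i • x i = 0 := by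
    have h1 := congrArg ι (congrFun hfφ q)
    simp only [Matrix.vecMul, dotProduct, Pi.zero_apply, map_sum, map_mul, map_zero] at h1
    rw [← h1]
    simp only [β, Finset.sum_smul]
    rw [Finset.sum_comm]
    refine Finset.sum_congr rfl fun j _ => ?_
    have h2 : ι (φ j q) = ∑ i, coeff (Finsupp.single i 1) (φ j q) • x i := by
      rw [← aeval_eq_sum_of_isHomogeneous_one (hφ j q)]
      have : (aeval x : MvPolynomial (Fin (n + 1)) k →ₐ[k] K) =
          IsScalarTower.toAlgHom k (MvPolynomial (Fin (n + 1)) k) K := by ext; simp [x, ι]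
      rw [this]; rfl
    rw [h2, Finset.mul_sum]
    refine Finset.sum_congr rfl fun i _ => ?_
    rw [smul_assoc, mul_smul_comm]
    rfl
  have hτβ : ∑ i, (β i : K) * (τ (x i) : K) = 0 := by
    have := congrArg (fun y => ((τ y : L) : K)) hβ
    simpa using this
  apply hι
  rw [map_zero, map_sum]
  have hterm : ∀ j, ι (f j * aeval (fun i => aeval f (G i)) (φ j q)) =
      ∑ i, ι (aeval f D) * ((coeff (Finsupp.single i 1) (φ j q) • fK j) * (τ (x i) : K)) := by
    intro j
    rw [aeval_eq_sum_of_isHomogeneous_one (hφ j q), map_mul, map_sum, Finset.mul_sum]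
    refine Finset.sum_congr rfl fun i _ => ?_
    have : ι (coeff (Finsupp.single i 1) (φ j q) • aeval f (G i)) =
        coeff (Finsupp.single i 1) (φ j q) • ι (aeval f (G i)) :=
      map_smul (IsScalarTower.toAlgHom k (MvPolynomial (Fin (n + 1)) k) K) _ _
    rw [this, hG, Algebra.smul_def, Algebra.smul_def]
    ring
  simp only [hterm]
  rw [Finset.sum_comm]
  simp only [← Finset.mul_sum, ← Finset.sum_mul]
  have : ∀ i, (β i : K) = ∑ j, coeff (Finsupp.single i 1) (φ j q) • fK j := fun i => by
    simp [β, fL]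
  simp only [← this, hτβ, mul_zero]

end ProjectiveMap

/-! ### Construction of the inverse map. -/

theorem mainTheorem3 {k : Type*} [Field k] {n m d c : ℕ}
    (f : Fin (m + 1) → MvPolynomial (Fin (n + 1)) k)
    (hf : ProjectiveMap.IsRationalDatum (MvPolynomial.homogeneousSubmodule (Fin (n + 1)) k) d f)
    (hdim : topologicalKrullDim (ProjectiveMap.image f) = (n : WithBot ℕ∞))
    (φ₁ : Matrix (Fin (m + 1)) (Fin c) (MvPolynomial (Fin (n + 1)) k))
    (hφ₁ : ProjectiveMap.IsLinearPart f φ₁)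
    (hrank : ProjectiveMap.HasRank φ₁ m) :
    ProjectiveMap.IsBirationalOntoImage f := by
  have hd := hf.one_le_degree
  have hfd : ∀ j, (f j).IsHomogeneous d := hf.mem_degree
  have hcol : ∀ s, φ₁.col s ∈ ProjectiveMap.linearSyzygies f := fun s =>
    hφ₁ ▸ Submodule.subset_span ⟨s, rfl⟩
  have hφ : ∀ i j, (φ₁ i j).IsHomogeneous 1 := fun i j => (hcol j).1 i
  have hfφ : Matrix.vecMul f φ₁ = 0 := by
    ext1 s
    have := (hcol s).2
    simpa only [Matrix.vecMul, dotProduct, mul_comm, Matrix.col_apply, Pi.zero_apply] using this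
  obtain ⟨j₁, hj₁⟩ : ∃ j, f j ≠ 0 := by
    by_contra! h
    refine hf.not_le_minimalPrime ⊥ (by simp [IsDomain.minimalPrimes_eq_singleton_bot]) ?_
    rw [Ideal.span_le]
    rintro _ ⟨j, rfl⟩
    simp [h j]
  obtain ⟨a, b, hdet⟩ : ∃ (a : Fin m → Fin (m + 1)) (b : Fin m → Fin c),
      (φ₁.submatrix a b).det ≠ 0 := by
    obtain ⟨x, hx, hx0⟩ := hrank.2
    by_contra! h
    refine nonZeroDivisors.ne_zero hx0 ?_
    have : ProjectiveMap.minorIdeal φ₁ m ≤ ⊥ := by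
      rw [ProjectiveMap.minorIdeal, Ideal.span_le]
      rintro _ ⟨a, b, rfl⟩
      exact h a b
    exact this hx
  have halg := ProjectiveMap.isAlgebraic_adjoin_of_le_topologicalKrullDim hd hfd hdim.ge
  obtain ⟨G, hG0, hG⟩ := ProjectiveMap.exists_aeval_solution
    (FractionRing (MvPolynomial (Fin (n + 1)) k)) f hφ hfφ
  have hprop := ProjectiveMap.mul_X_eq_mul_X_of_linear_syzygies hd hfd
    (fun h => hj₁ (congrFun h j₁)) halg hφ hfφ hdet hG
  -- The relations with `X` are homogeneous, so one component of `G` with nonzero entry at `0`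
  -- suffices.
  obtain ⟨e, he⟩ : ∃ e, aeval f (homogeneousComponent e (G 0)) ≠ 0 := by
    by_contra! h
    refine hG0 ?_
    rw [← sum_homogeneousComponent (G 0), map_sum]
    exact Finset.sum_eq_zero fun i _ => h i
  have hcomp : ∀ i j, aeval f (homogeneousComponent e (G i)) * X j =
      aeval f (homogeneousComponent e (G j)) * (X i : MvPolynomial (Fin (n + 1)) k) := by
    intro i j
    rw [← homogeneousComponent_aeval hd hfd, ← homogeneousComponent_aeval hd hfd,
      ← ProjectiveMap.homogeneousComponent_mul_X, ← ProjectiveMap.homogeneousComponent_mul_X]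
    exact congrArg _ (hprop i j)
  -- The common factor `X j₁`, with `f j₁ ≠ 0`, makes the degree positive even when `e = 0`.
  let q : Fin (n + 1) → MvPolynomial (Fin (m + 1)) k := fun i => homogeneousComponent e (G i) * X j₁
  have hq : ∀ i, (q i).IsHomogeneous (e + 1) := fun i =>
    (homogeneousComponent_isHomogeneous e (G i)).mul (isHomogeneous_X k j₁)
  have hq0 : aeval f (q 0) ≠ 0 := by
    simp only [q, map_mul, aeval_X]
    exact mul_ne_zero he hj₁
  have hprime : (ProjectiveMap.imageIdeal f).IsPrime := RingHom.ker_isPrime _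
  refine ⟨e + 1, fun i => Ideal.Quotient.mk _ (q i), ⟨by omega, fun i => ⟨q i, hq i, rfl⟩,
    inferInstance, ?_⟩, aeval f (q 0), X 0, mem_nonZeroDivisors_of_ne_zero hq0,
    mem_nonZeroDivisors_of_ne_zero (X_ne_zero 0), ⟨_, (hq 0).aeval f hfd⟩,
    ⟨1, isHomogeneous_X k 0⟩, fun i => ?_⟩
  · intro P hP hle
    rw [IsDomain.minimalPrimes_eq_singleton_bot, Set.mem_singleton_iff] at hP
    subst hP
    have h0 : Ideal.Quotient.mk (ProjectiveMap.imageIdeal f) (q 0) = 0 :=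
      hle (Ideal.subset_span ⟨0, rfl⟩)
    exact hq0 (Ideal.Quotient.eq_zero_iff_mem.1 h0)
  · change aeval f (q 0) * X i = X 0 * aeval f (q i)
    simp only [q, map_mul, aeval_X]
    linear_combination f j₁ * hcomp 0 i
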